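/- Let $\Phi$ be a nonzero completely positive linear map on complex $2\times 2$ matrices (a one-qubit channel; it need not be trace preserving). Let $|I\rangle=|00\rangle+|11\rangle$, let $\rho_\Phi=(I_2\otimes\Phi)(|I\rangle\langle I|)$ be its dual operator, and let $C$ be the concurrence of the normalized dual state $\hat\rho=\rho_\Phi/\mathrm{Tr}\,\rho_\Phi$, that is, $C=\max(0,\lambda_1-\lambda_2-\lambda_3-\lambda_4)$, where $\lambda_1\ge\lambda_2\ge\lambda_3\ge\lambda_4\ge 0$ are the square roots of the eigenvalues, with algebraic multiplicity, of $\hat\rho\,(\sigma_y\otimes\sigma_y)\,\hat\rho^{*}\,(\sigma_y\otimes\sigma_y)$, with ${}^{*}$ the entrywise complex conjugation and $\sigma_y=\begin{pmatrix}0&-i\\ i&0\end{pmatrix}$. Then $0\le C\le 1$, and there are finitely many real numbers $p_i\ge 0$ with $\sum_i p_i=\mathrm{Tr}\,\rho_\Phi$ (which equals $2$ if $\Phi$ is trace preserving) and unitary $2\times 2$ matrices $U_i,V_i$ such that, for every complex $2\times2$ matrix $\rho$, $$\Phi(\rho)=\sum_i p_i\,(U_i\tilde C V_i)\,\rho\,(U_i\tilde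 C V_i)^\dagger,\qquad \tilde C=\frac12\begin{pmatrix}\sqrt{1+C}+\sqrt{1-C}&0\\0&\sqrt{1+C}-\sqrt{1-C}\end{pmatrix}.$$ -/

import Mathlib

open scoped Matrix Kronecker ComplexOrder

noncomputable section

/-- The linear extension `I_m ⊗ Φ` of a map `Φ` on `n × n` matrices to the matrices on
`ℂ^m ⊗ ℂ^n`: it applies `Φ` to each of the `n × n` blocks. -/
def idTensor {m n : ℕ} (Φ : Matrix (Fin n) (Fin n) ℂ →ₗ[ℂ] Matrix (Fin n) (Fin n) ℂ)
    (X : Matrix (Fin m × Fin n) (Fin m × Fin n) ℂ) :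
    Matrix (Fin m × Fin n) (Fin m × Fin n) ℂ :=
  Matrix.of fun r s => Φ (Matrix.of fun a b => X (r.1, a) (s.1, b)) r.2 s.2

/-- `Φ` is completely positive: `I_m ⊗ Φ` preserves positive semidefiniteness for every `m`. -/
def IsCompletelyPositive {n : ℕ}
    (Φ : Matrix (Fin n) (Fin n) ℂ →ₗ[ℂ] Matrix (Fin n) (Fin n) ℂ) : Prop :=
  ∀ (m : ℕ) (X : Matrix (Fin m × Fin n) (Fin m × Fin n) ℂ),
    X.PosSemidef → (idTensor Φ X).PosSemidef

/-- The unnormalized maximally entangled vector `|I⟩ = ∑ i, |i⟩|i⟩`. -/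
def maxEntangled (n : ℕ) : Fin n × Fin n → ℂ := fun r => if r.1 = r.2 then 1 else 0

/-- The dual operator `(I_n ⊗ Φ)(|I⟩⟨I|)` of a map `Φ`. -/
def dualOperator {n : ℕ} (Φ : Matrix (Fin n) (Fin n) ℂ →ₗ[ℂ] Matrix (Fin n) (Fin n) ℂ) :
    Matrix (Fin n × Fin n) (Fin n × Fin n) ℂ :=
  idTensor Φ (Matrix.vecMulVec (maxEntangled n) (star (maxEntangled n)))

/-- The dual state of `Φ`: its dual operator, normalized to trace one. -/
def dualState {n : ℕ} (Φ : Matrix (Fin n) (Fin n) ℂ →ₗ[ℂ] Matrix (Fin n) (Fin n) ℂ) :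
    Matrix (Fin n × Fin n) (Fin n × Fin n) ℂ :=
  (dualOperator Φ).trace⁻¹ • dualOperator Φ

/-- The Pauli matrix `σ_y`. -/
def pauliY : Matrix (Fin 2) (Fin 2) ℂ := !![0, -Complex.I; Complex.I, 0]

/-- The spin-flipped matrix `(σ_y ⊗ σ_y) ρ^* (σ_y ⊗ σ_y)`, where `ρ^*` is the entrywise complex
conjugate of `ρ`. -/
def spinFlip (ρ : Matrix (Fin 2 × Fin 2) (Fin 2 × Fin 2) ℂ) :
    Matrix (Fin 2 × Fin 2) (Fin 2 × Fin 2) ℂ :=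
  (pauliY ⊗ₖ pauliY) * ρ.map star * (pauliY ⊗ₖ pauliY)

/-- The square roots of the four eigenvalues of `ρ * spinFlip ρ`, counted with algebraic
multiplicity (for a state `ρ` these eigenvalues are real and nonnegative), in decreasing order. -/
def concurrenceSpectrum (ρ : Matrix (Fin 2 × Fin 2) (Fin 2 × Fin 2) ℂ) : List ℝ :=
  ((ρ * spinFlip ρ).charpoly.roots.map fun z => Real.sqrt z.re).sort (fun a b => a ≥ b)

/-- The concurrence `max(0, l₁ - l₂ - l₃ - l₄)` of a two-qubit state. -/
def concurrence (ρ : Matrix (Fin 2 × Fin 2) (Fin 2 × Fin 2) ℂ) : ℝ :=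
  max 0 ((concurrenceSpectrum ρ).getD 0 0 - (concurrenceSpectrum ρ).getD 1 0
    - (concurrenceSpectrum ρ).getD 2 0 - (concurrenceSpectrum ρ).getD 3 0)

/-- The diagonal matrix `½ diag(√(1+C) + √(1-C), √(1+C) - √(1-C))`. -/
def concurrenceDiag (C : ℝ) : Matrix (Fin 2) (Fin 2) ℂ :=
  Matrix.diagonal ![((1 / 2 * (Real.sqrt (1 + C) + Real.sqrt (1 - C)) : ℝ) : ℂ),
    ((1 / 2 * (Real.sqrt (1 + C) - Real.sqrt (1 - C)) : ℝ) : ℂ)]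

end

/-!
A decomposition `dualState Φ = ∑ k, b_k b_kᴴ` is the same as a Kraus decomposition of `Φ`, up to the
factor `Tr ρ_Φ`: the vector `b_k` of `ℂ² ⊗ ℂ²` becomes a `2 × 2` matrix `K_k`. Under this
correspondence `‖b_k‖² = Tr (K_kᴴ K_k)` and `b_kᵀ (σ_y ⊗ σ_y) b_k = -2 det K_k`. The trace of `Kᴴ K`
and the modulus of `det K` determine the singular values of `K`, so a matrix with
`Tr (Kᴴ K) = q` and `2 |det K| = C q` is `√q U C̃ V` with `U`, `V` unitary
(`exists_unitary_eq_concurrenceDiag`). What is needed is therefore Wootters' theorem, that a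
two-qubit state `ρ` has a decomposition into vectors which all have the concurrence of `ρ`
(`exists_decomposition_concurrence`).

Write `ρ = B Bᴴ`. The Takagi factorization (`Matrix.exists_takagi`) of the symmetric matrix
`Bᵀ (σ_y ⊗ σ_y) B` lets one replace `B` by `B W`, `W` unitary, so that this matrix becomes
`diag d` with `d` nonnegative and decreasing; the `d i` are then the square roots of the eigenvalues
of `ρ * spinFlip ρ` (`concurrenceSpectrum_mul_conjTranspose`). There are two cases.

* If `d 0 ≤ d 1 + d 2 + d 3`, the concurrence is zero, and there is a closed quadrilateral with
  sides `d i`, that is, phases `w i` with `∑ i, (w i)² d i = 0`. Multiplying the columns of `B` by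
  these phases and then applying the `4 × 4` Hadamard matrix makes the four diagonal entries of
  `Bᵀ (σ_y ⊗ σ_y) B` equal, hence zero.
* If `d 0 ≥ d 1 + d 2 + d 3`, the phases `1, i, i, i` turn `diag d` into a real diagonal matrix `D`
  of trace `C`. The real symmetric matrix `D - C Re (Bᴴ B)` has trace zero, so some real orthogonal
  matrix conjugates it to one with zero diagonal (`exists_orthogonal_conj_diag_eq_zero`), which
  says that every new column `b` satisfies `bᵀ (σ_y ⊗ σ_y) b = C ‖b‖²`. Since
  `|bᵀ (σ_y ⊗ σ_y) b| ≤ ‖b‖²` for every `b`, taking the trace of `D` gives `C ≤ 1`.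
-/

/-! ### Takagi factorization of complex symmetric matrices -/

section Takagi
variable {V : Type*} [NormedAddCommGroup V] [InnerProductSpace ℂ V] [FiniteDimensional ℂ V]

/-- An antilinear map with `⟪u, T v⟫ = ⟪v, T u⟫` is a symmetric operator on the underlying real
inner product space, so it has a real eigenvalue. -/
theorem exists_unit_coneigenvector [Nontrivial V] (T : V →ₛₗ[starRingEnd ℂ] V)
    (hT : ∀ u v, inner ℂ u (T v) = inner ℂ v (T u)) :
    ∃ x : V, ‖x‖ = 1 ∧ ∃ d : ℝ, 0 ≤ d ∧ T x = (d : ℂ) • x := by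
  let S : V →ₗ[ℝ] V :=
    { toFun := T
      map_add' := T.map_add
      map_smul' := fun r x => by
        have h := T.map_smulₛₗ (r : ℂ) x
        simpa using h }
  let _ : InnerProductSpace ℝ V := InnerProductSpace.complexToReal
  have hS : LinearMap.IsSymmetric (𝕜 := ℝ) S := fun x y => by
    change (inner ℂ (T x) y).re = (inner ℂ x (T y)).re
    rw [← inner_conj_symm, hT, Complex.conj_re]
  have : FiniteDimensional ℝ V := FiniteDimensional.complexToReal V
  obtain ⟨μ, hμ⟩ : ∃ μ, Module.End.HasEigenvalue S μ := by
    by_contra h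
    rw [not_exists] at h
    exact not_subsingleton V (hS.subsingleton_of_no_eigenvalue_finiteDimensional fun μ =>
      not_not.1 (h μ))
  obtain ⟨y, hy⟩ := hμ.exists_hasEigenvector
  have hTy : T y = (μ : ℂ) • y := by
    have := hy.apply_eq_smul
    simpa [S] using this
  have hy0 : ‖y‖ ≠ 0 := norm_ne_zero_iff.mpr hy.2
  -- The map is antilinear, so multiplying a coneigenvector by `i` flips the sign of its value.
  obtain ⟨z, hz0, d, hd, hz⟩ : ∃ z : V, ‖z‖ ≠ 0 ∧ ∃ d : ℝ, 0 ≤ d ∧ T z = (d : ℂ) • z := by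
    rcases le_total 0 μ with h | h
    · exact ⟨y, hy0, μ, h, hTy⟩
    · refine ⟨Complex.I • y, by simpa [norm_smul] using hy0, -μ, by linarith, ?_⟩
      rw [T.map_smulₛₗ, hTy, smul_smul, smul_smul]
      congr 1
      simp [mul_comm]
  refine ⟨((‖z‖⁻¹ : ℝ) : ℂ) • z, ?_, d, hd, ?_⟩
  · rw [norm_smul, Complex.norm_real, norm_inv, norm_norm, inv_mul_cancel₀ hz0]
  · rw [T.map_smulₛₗ, hz, Complex.conj_ofReal, smul_comm]

/-- The vectors are found one at a time: the orthogonal complement of those already found is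
invariant under `T`. -/
theorem exists_orthonormal_coneigenvectors (T : V →ₛₗ[starRingEnd ℂ] V)
    (hT : ∀ u v, inner ℂ u (T v) = inner ℂ v (T u)) (k : ℕ) (hk : k ≤ Module.finrank ℂ V) :
    ∃ (v : Fin k → V) (d : Fin k → ℝ), Orthonormal ℂ v ∧ (∀ i, 0 ≤ d i) ∧
      ∀ i, T (v i) = (d i : ℂ) • v i := by
  induction k with
  | zero => exact ⟨Fin.elim0, Fin.elim0, ⟨fun i => i.elim0, fun i => i.elim0⟩,
      fun i => i.elim0, fun i => i.elim0⟩
  | succ k ih =>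
    obtain ⟨v, d, hv, hd, hTv⟩ := ih (by omega)
    let W : Submodule ℂ V := (Submodule.span ℂ (Set.range v))ᗮ
    have hmem : ∀ x, x ∈ W ↔ ∀ i, inner ℂ (v i) x = 0 := fun x => by
      rw [Submodule.mem_orthogonal]
      refine ⟨fun h i => h _ (Submodule.subset_span ⟨i, rfl⟩), fun h u hu => ?_⟩
      induction hu using Submodule.span_induction with
      | mem u hu => obtain ⟨i, rfl⟩ := hu; exact h i
      | zero => simp
      | add a b _ _ ha hb => rw [inner_add_left, ha, hb, add_zero]
      | smul c a _ ha => rw [inner_smul_left, ha, mul_zero]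
    have hTW : ∀ x ∈ W, T x ∈ W := fun x hx => by
      rw [hmem] at hx ⊢
      intro i
      rw [hT, hTv, inner_smul_right, ← inner_conj_symm, hx, map_zero, mul_zero]
    have hspan : Module.finrank ℂ (Submodule.span ℂ (Set.range v)) = k := by
      rw [finrank_span_eq_card hv.linearIndependent, Fintype.card_fin]
    have hsum := Submodule.finrank_add_finrank_orthogonal (Submodule.span ℂ (Set.range v))
    have : Nontrivial W := Module.nontrivial_of_finrank_pos (R := ℂ) (by
      change 0 < Module.finrank ℂ (Submodule.span ℂ (Set.range v))ᗮ
      omega)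
    let S : W →ₛₗ[starRingEnd ℂ] W :=
      { toFun := fun x => ⟨T x, hTW x x.2⟩
        map_add' := fun x y => Subtype.ext (by simp)
        map_smul' := fun c x => Subtype.ext (by simp) }
    obtain ⟨x, hx, e, he, hSx⟩ := exists_unit_coneigenvector S fun a b => hT a b
    refine ⟨Fin.snoc v (x : V), Fin.snoc d e, ?_, ?_, ?_⟩
    · have hxv := (hmem x).1 x.2
      rw [orthonormal_iff_ite] at hv ⊢
      intro i j
      refine Fin.lastCases ?_ (fun i => ?_) i <;> refine Fin.lastCases ?_ (fun j => ?_) j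
      · simp only [Fin.snoc_last, if_true, inner_self_eq_norm_sq_to_K]
        rw [Submodule.coe_norm] at hx
        simp [hx]
      · rw [Fin.snoc_last, Fin.snoc_castSucc, ← inner_conj_symm, hxv, map_zero,
          if_neg (Fin.castSucc_lt_last j).ne']
      · rw [Fin.snoc_last, Fin.snoc_castSucc, hxv, if_neg (Fin.castSucc_lt_last i).ne]
      · simpa using hv i j
    · exact Fin.lastCases (by simpa using he) (fun i => by simpa using hd i)
    · exact Fin.lastCases (by simpa [S] using congrArg Subtype.val hSx)
        (fun i => by simpa using hTv i)

end Takagi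

/-- **Autonne–Takagi factorization**: a complex symmetric matrix is unitarily congruent to a
nonnegative diagonal one. It is obtained from the antilinear map `v ↦ star (A v)`, whose orthonormal
basis `v i` with `star (A (v i)) = d i • v i` gives the columns of `W`. -/
theorem Matrix.exists_takagi {n : ℕ} (A : Matrix (Fin n) (Fin n) ℂ) (hA : Aᵀ = A) :
    ∃ (W : Matrix (Fin n) (Fin n) ℂ) (d : Fin n → ℝ), W ∈ Matrix.unitaryGroup (Fin n) ℂ ∧
      (∀ i, 0 ≤ d i) ∧ Antitone d ∧ Wᵀ * A * W = Matrix.diagonal fun i => (d i : ℂ) := by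
  let T : EuclideanSpace ℂ (Fin n) →ₛₗ[starRingEnd ℂ] EuclideanSpace ℂ (Fin n) :=
    { toFun := fun v => WithLp.toLp 2 (star (A *ᵥ v.ofLp))
      map_add' := fun u v => by ext i; simp [Matrix.mulVec_add]
      map_smul' := fun c v => by ext i; simp [Matrix.mulVec_smul] }
  have hT : ∀ u v, inner ℂ u (T v) = inner ℂ v (T u) := fun u v => by
    simp only [EuclideanSpace.inner_eq_star_dotProduct, T, LinearMap.coe_mk, AddHom.coe_mk]
    rw [Matrix.star_dotProduct_star, Matrix.star_dotProduct_star, Matrix.dotProduct_mulVec,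
      ← Matrix.mulVec_transpose, hA, dotProduct_comm]
  obtain ⟨v, d, hv, hd, hTv⟩ := exists_orthonormal_coneigenvectors T hT n (by simp)
  -- Sorting the negated values puts the Takagi values in decreasing order.
  let σ : Equiv.Perm (Fin n) := Tuple.sort fun i => -d i
  have hσ : Antitone (d ∘ σ) := fun i j hij => by
    simpa using Tuple.monotone_sort (fun i => -d i) hij
  have hW : (Matrix.of fun i j => v (σ j) i) ∈ Matrix.unitaryGroup (Fin n) ℂ := by
    rw [Matrix.mem_unitaryGroup_iff']
    ext i j
    have := (orthonormal_iff_ite.1 (hv.comp σ σ.injective)) i j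
    rw [Matrix.one_apply, ← this]
    simp [EuclideanSpace.inner_eq_star_dotProduct, Matrix.mul_apply, dotProduct, mul_comm]
  refine ⟨_, d ∘ σ, hW, fun i => hd _, hσ, ?_⟩
  have hcol : A * (Matrix.of fun i j => v (σ j) i) =
      (Matrix.of fun i j => v (σ j) i).map star * Matrix.diagonal fun i => ((d ∘ σ) i : ℂ) := by
    ext i j
    have h := congrArg (fun w : EuclideanSpace ℂ (Fin n) => star (w i)) (hTv (σ j))
    rw [Matrix.mul_diagonal]
    simp [T, Matrix.mulVec, dotProduct] at h
    simp [Matrix.mul_apply, h, mul_comm]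
  rw [Matrix.mul_assoc, hcol, ← Matrix.mul_assoc]
  have h2 := (Matrix.mem_unitaryGroup_iff').1 hW
  have h3 := congrArg Matrix.transpose h2
  rw [Matrix.transpose_mul, Matrix.transpose_one, Matrix.star_eq_conjTranspose,
    Matrix.conjTranspose, Matrix.transpose_map, Matrix.transpose_transpose] at h3
  rw [h3, Matrix.one_mul]

/-! ### Equal diagonal entries, and phases that close a quadrilateral -/

/-- Half of the `4 × 4` Hadamard matrix, an orthogonal matrix all of whose entries are `±1/2`. -/
noncomputable def hadamardFour : Matrix (Fin 4) (Fin 4) ℝ :=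
  (1 / 2 : ℝ) • !![1, 1, 1, 1; 1, -1, 1, -1; 1, 1, -1, -1; 1, -1, -1, 1]

theorem hadamardFour_sq (i j : Fin 4) : hadamardFour i j ^ 2 = 1 / 4 := by
  fin_cases i <;> fin_cases j <;> norm_num [hadamardFour]

theorem hadamardFour_mem : hadamardFour ∈ Matrix.orthogonalGroup (Fin 4) ℝ := by
  rw [Matrix.mem_orthogonalGroup_iff]
  ext i j
  fin_cases i <;> fin_cases j <;>
    simp [hadamardFour, Matrix.mul_apply, Fin.sum_univ_four] <;> norm_num

/-- The Hadamard matrix spreads the trace of a diagonal matrix evenly over the diagonal. -/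
theorem transpose_mul_diagonal_mul_hadamardFour_apply (x : Fin 4 → ℂ) (i : Fin 4) :
    ((hadamardFour.map ((↑) : ℝ → ℂ))ᵀ * Matrix.diagonal x * hadamardFour.map ((↑) : ℝ → ℂ)) i i =
      (∑ j, x j) / 4 := by
  rw [Matrix.mul_apply, Finset.sum_div]
  refine Finset.sum_congr rfl fun j _ => ?_
  have h : ((hadamardFour j i : ℂ)) ^ 2 = 1 / 4 := by
    rw [← Complex.ofReal_pow, hadamardFour_sq]; norm_num
  simp only [Matrix.mul_diagonal, Matrix.transpose_apply, Matrix.map_apply]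
  linear_combination x j * h

/-- After diagonalization, the Hadamard matrix makes all diagonal entries equal to a quarter of the
trace. -/
theorem exists_orthogonal_conj_diag_eq_zero (S : Matrix (Fin 4) (Fin 4) ℝ) (hS : Sᵀ = S)
    (htr : S.trace = 0) :
    ∃ O ∈ Matrix.orthogonalGroup (Fin 4) ℝ, ∀ i, (Oᵀ * S * O) i i = 0 := by
  have hH : S.IsHermitian := hS
  let Q := (hH.eigenvectorUnitary : Matrix (Fin 4) (Fin 4) ℝ)
  have hd : Qᵀ * S * Q = Matrix.diagonal hH.eigenvalues := by
    have := hH.conjStarAlgAut_star_eigenvectorUnitary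
    rw [Unitary.conjStarAlgAut_star_apply] at this
    exact this
  refine ⟨Q * hadamardFour, mul_mem hH.eigenvectorUnitary.2 hadamardFour_mem, fun i => ?_⟩
  have hsum : ∑ j, hH.eigenvalues j = 0 := by
    rw [← htr]
    exact hH.trace_eq_sum_eigenvalues.symm
  have : (Q * hadamardFour)ᵀ * S * (Q * hadamardFour) =
      hadamardFourᵀ * Matrix.diagonal hH.eigenvalues * hadamardFour := by
    rw [← hd, Matrix.transpose_mul]
    simp only [Matrix.mul_assoc]
  rw [this, Matrix.mul_apply]
  calc _ = ∑ j, hH.eigenvalues j * hadamardFour j i ^ 2 :=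
        Finset.sum_congr rfl fun j _ => by
          simp only [Matrix.mul_diagonal, Matrix.transpose_apply]; ring
    _ = 0 := by simp only [hadamardFour_sq, ← Finset.sum_mul, hsum, zero_mul]

/-- Three lengths that satisfy the triangle inequalities are the sides of a triangle: the length of
`a + b e^{it}` takes every value between `a + b` and `|a - b|`. -/
theorem exists_triangle {a b r : ℝ} (ha : 0 ≤ a) (hb : 0 ≤ b) (h₁ : |a - b| ≤ r)
    (h₂ : r ≤ a + b) : ∃ z w : ℂ, ‖z‖ = 1 ∧ ‖w‖ = 1 ∧ a * z + b * w = r := by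
  let f : ℝ → ℝ := fun t => ‖(a : ℂ) + b * Complex.exp (t * Complex.I)‖
  have hf : ContinuousOn f (Set.Icc 0 Real.pi) := by fun_prop
  have h0 : f 0 = a + b := by
    simp only [f, Complex.ofReal_zero, zero_mul, Complex.exp_zero, mul_one]
    rw [← Complex.ofReal_add, Complex.norm_real, Real.norm_of_nonneg (by positivity)]
  have hπ : f Real.pi = |a - b| := by
    simp only [f, Complex.exp_pi_mul_I, mul_neg, mul_one]
    rw [← sub_eq_add_neg, ← Complex.ofReal_sub, Complex.norm_real, Real.norm_eq_abs]
  obtain ⟨t, -, ht⟩ := intermediate_value_Icc' Real.pi_pos.le hf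
    (show r ∈ Set.Icc (f Real.pi) (f 0) by rw [h0, hπ]; exact ⟨h₁, h₂⟩)
  set u : ℂ := (a : ℂ) + b * Complex.exp (t * Complex.I) with hu
  have harg := Complex.norm_mul_exp_arg_mul_I u
  let c : ℂ := Complex.exp (((-u.arg : ℝ) : ℂ) * Complex.I)
  have hc : u * c = r := by
    rw [← harg, mul_assoc, ← Complex.exp_add, ← show ‖u‖ = r from ht]
    simp
  refine ⟨c, Complex.exp (t * Complex.I) * c, Complex.norm_exp_ofReal_mul_I _, ?_, ?_⟩
  · rw [norm_mul, Complex.norm_exp_ofReal_mul_I, Complex.norm_exp_ofReal_mul_I, one_mul]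
  · rw [← hc, hu]; ring

/-- Four lengths, none of which exceeds the sum of the others, are the sides of a closed
quadrilateral. The phases are written as squares `w i ^ 2`, since multiplying a vector `b` by `w`
multiplies the bilinear form `bᵀ Y b` by `w ^ 2`. -/
theorem exists_phases_sum_eq_zero (d : Fin 4 → ℝ) (h0 : ∀ i, 0 ≤ d i) (hd : Antitone d)
    (h : d 0 ≤ d 1 + d 2 + d 3) :
    ∃ w : Fin 4 → ℂ, (∀ i, ‖w i‖ = 1) ∧ ∑ i, w i ^ 2 * d i = 0 := by
  have h01 : d 1 ≤ d 0 := hd (by decide)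
  have h12 : d 2 ≤ d 1 := hd (by decide)
  have h23 : d 3 ≤ d 2 := hd (by decide)
  have h3 := h0 3
  -- A diagonal of the quadrilateral with sides `d i` that closes both triangles.
  let r := max (d 0 - d 1) (d 2 - d 3)
  have hr1 : d 0 - d 1 ≤ r := le_max_left _ _
  have hr2 : d 2 - d 3 ≤ r := le_max_right _ _
  obtain ⟨z₀, z₁, hz₀, hz₁, hz⟩ := exists_triangle (r := r) (h0 0) (h0 1)
    (by rw [abs_of_nonneg (by linarith)]; exact hr1)
    (max_le (by linarith) (by linarith))
  obtain ⟨z₂, z₃, hz₂, hz₃, hz'⟩ := exists_triangle (r := r) (h0 2) (h0 3)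
    (by rw [abs_of_nonneg (by linarith)]; exact hr2)
    (max_le (by linarith) (by linarith))
  have hroot : ∀ z : ℂ, ‖z‖ = 1 → ∃ w : ℂ, ‖w‖ = 1 ∧ w ^ 2 = z := fun z hz => by
    obtain ⟨w, hw⟩ := IsAlgClosed.exists_pow_nat_eq z (n := 2) (by norm_num)
    refine ⟨w, ?_, hw⟩
    rw [← hw, norm_pow] at hz
    exact (pow_eq_one_iff_of_nonneg (norm_nonneg _) two_ne_zero).1 hz
  obtain ⟨w₀, hw₀, rfl⟩ := hroot z₀ hz₀
  obtain ⟨w₁, hw₁, rfl⟩ := hroot z₁ hz₁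
  obtain ⟨w₂, hw₂, h₂⟩ := hroot (-z₂) (by rwa [norm_neg])
  obtain ⟨w₃, hw₃, h₃⟩ := hroot (-z₃) (by rwa [norm_neg])
  refine ⟨![w₀, w₁, w₂, w₃], fun i => by fin_cases i <;> assumption, ?_⟩
  simp only [Fin.sum_univ_four, Matrix.cons_val]
  rw [h₂, h₃]
  linear_combination hz - hz'

/-! ### Singular value decomposition of `2 × 2` matrices -/

/-- The trace and the determinant of a `2 × 2` Hermitian matrix determine its eigenvalues, and the
diagonalization can list them in either order. -/
theorem Matrix.IsHermitian.exists_unitary_conj_eq {H : Matrix (Fin 2) (Fin 2) ℂ}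
    (hH : H.IsHermitian) {x y : ℝ} (htr : H.trace = x + y) (hdet : H.det = x * y) :
    ∃ Q ∈ Matrix.unitaryGroup (Fin 2) ℂ, Qᴴ * H * Q = !![(x : ℂ), 0; 0, (y : ℂ)] := by
  obtain ⟨Q, hQ, e, f, he⟩ : ∃ Q ∈ Matrix.unitaryGroup (Fin 2) ℂ, ∃ e f : ℝ,
      Qᴴ * H * Q = !![(e : ℂ), 0; 0, (f : ℂ)] := by
    refine ⟨_, hH.eigenvectorUnitary.2, hH.eigenvalues 0, hH.eigenvalues 1, ?_⟩
    have := hH.conjStarAlgAut_star_eigenvectorUnitary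
    rw [Unitary.conjStarAlgAut_star_apply] at this
    refine this.trans ?_
    ext i j
    fin_cases i <;> fin_cases j <;> simp
  have hQ' : Q * Qᴴ = 1 := Matrix.mem_unitaryGroup_iff.1 hQ
  have h1 : (e : ℂ) + f = x + y := by
    rw [← htr, ← Matrix.mul_one H, ← hQ', ← Matrix.mul_assoc, Matrix.trace_mul_comm,
      ← Matrix.mul_assoc, he, Matrix.trace_fin_two]
    simp
  have h2 : (e : ℂ) * f = x * y := by
    rw [← hdet, ← Matrix.mul_one H, ← hQ', ← Matrix.mul_assoc, Matrix.det_mul_comm,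
      ← Matrix.mul_assoc, he, Matrix.det_fin_two]
    simp
  have h1' : e + f = x + y := by exact_mod_cast h1
  have h2' : e * f = x * y := by exact_mod_cast h2
  have h3 : (e - x) * (e - y) = 0 := by linear_combination e * h1' - h2'
  rcases mul_eq_zero.1 h3 with h | h
  · obtain rfl : e = x := by linarith
    obtain rfl : f = y := by linarith
    exact ⟨Q, hQ, he⟩
  · obtain rfl : e = y := by linarith
    obtain rfl : f = x := by linarith
    have hP : !![(0 : ℂ), 1; 1, 0] ∈ Matrix.unitaryGroup (Fin 2) ℂ := by
      rw [Matrix.mem_unitaryGroup_iff]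
      ext i j
      fin_cases i <;> fin_cases j <;> simp [Matrix.mul_apply]
    refine ⟨Q * !![0, 1; 1, 0], mul_mem hQ hP, ?_⟩
    rw [Matrix.conjTranspose_mul, show !![(0 : ℂ), 1; 1, 0]ᴴ * Qᴴ * H * (Q * !![0, 1; 1, 0]) =
      !![(0 : ℂ), 1; 1, 0]ᴴ * (Qᴴ * H * Q) * !![0, 1; 1, 0] by simp only [Matrix.mul_assoc], he]
    ext i j
    fin_cases i <;> fin_cases j <;> simp [Matrix.mul_apply]

theorem mem_unitaryGroup_of_column {u v c : ℂ} (h : star u * u + star v * v = 1)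
    (hc : c * star c = 1) :
    !![u, -(star v * c); v, star u * c] ∈ Matrix.unitaryGroup (Fin 2) ℂ := by
  rw [Matrix.mem_unitaryGroup_iff', Matrix.star_eq_conjTranspose]
  ext i j
  fin_cases i <;> fin_cases j <;>
    simp only [Fin.zero_eta, Fin.mk_one, Matrix.mul_apply, Fin.sum_univ_two,
      Matrix.conjTranspose_apply, Matrix.of_apply, Matrix.cons_val, Matrix.one_apply_eq, ne_eq,
      zero_ne_one, one_ne_zero, not_false_eq_true, Matrix.one_apply_ne, star_neg, star_mul,
      star_star]
  · exact h
  · ring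
  · ring
  · linear_combination (c * star c) * h + hc

/-- A matrix with orthogonal columns, the first of norm `s > 0`, is a unitary matrix times a
diagonal one; `t = 0` is allowed. -/
theorem Matrix.exists_unitary_mul_diagonal (M : Matrix (Fin 2) (Fin 2) ℂ) {s t : ℝ}
    (hs : 0 < s) (h00 : (Mᴴ * M) 0 0 = (s : ℂ) ^ 2) (h01 : (Mᴴ * M) 0 1 = 0)
    (hdet : ‖M.det‖ = s * t) :
    ∃ U ∈ Matrix.unitaryGroup (Fin 2) ℂ, M = U * Matrix.diagonal ![(s : ℂ), (t : ℂ)] := by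
  simp only [Matrix.mul_apply, Fin.sum_univ_two, Matrix.conjTranspose_apply] at h00 h01
  -- The phase of `det M` completes the first column of `M` to a unitary matrix.
  obtain ⟨c, hcc, harg⟩ : ∃ c : ℂ, c * star c = 1 ∧ (s : ℂ) * t * c = M.det := by
    refine ⟨Complex.exp (M.det.arg * Complex.I), ?_, ?_⟩
    · rw [Complex.star_def, Complex.mul_conj, Complex.normSq_eq_norm_sq,
        Complex.norm_exp_ofReal_mul_I, one_pow, Complex.ofReal_one]
    · rw [← Complex.ofReal_mul, ← hdet, Complex.norm_mul_exp_arg_mul_I]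
  rw [Matrix.det_fin_two] at harg
  have hs' : (s : ℂ) ≠ 0 := Complex.ofReal_ne_zero.2 hs.ne'
  have hss : star (s : ℂ) = s := Complex.conj_ofReal s
  refine ⟨_, mem_unitaryGroup_of_column (u := M 0 0 / s) (v := M 1 0 / s) (c := c) ?_ hcc, ?_⟩
  · rw [star_div₀, star_div₀, hss]
    field_simp
    exact h00
  ext i j
  rw [Matrix.mul_diagonal]
  fin_cases i <;> fin_cases j <;> simp only [Fin.zero_eta, Fin.mk_one, Matrix.of_apply,
    Matrix.cons_val, star_div₀, hss] <;> field_simp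
  · refine mul_left_cancel₀ hs' ?_
    linear_combination (-M 0 1) * h00 + M 0 0 * h01 + star (M 1 0) * harg
  · refine mul_left_cancel₀ hs' ?_
    linear_combination (-M 1 1) * h00 + M 1 0 * h01 - star (M 0 0) * harg

/-- The singular value decomposition of a `2 × 2` matrix, with the singular values prescribed
through `Tr (Kᴴ K)` and `|det K|`. -/
theorem Matrix.exists_unitary_mul_diagonal_mul (K : Matrix (Fin 2) (Fin 2) ℂ) {s t : ℝ}
    (hs : 0 < s) (htr : (Kᴴ * K).trace = (s : ℂ) ^ 2 + (t : ℂ) ^ 2) (hdet : ‖K.det‖ = s * t) :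
    ∃ U V : Matrix.unitaryGroup (Fin 2) ℂ,
      K = (U : Matrix (Fin 2) (Fin 2) ℂ) * Matrix.diagonal ![(s : ℂ), (t : ℂ)] * V := by
  have hH : (Kᴴ * K).IsHermitian := Matrix.isHermitian_conjTranspose_mul_self K
  obtain ⟨Q, hQ, hd⟩ := hH.exists_unitary_conj_eq (x := s ^ 2) (y := t ^ 2)
    (by rw [htr, Complex.ofReal_pow, Complex.ofReal_pow]) (by
      rw [Matrix.det_mul, Matrix.det_conjTranspose, mul_comm, Complex.star_def,
        Complex.mul_conj, Complex.normSq_eq_norm_sq, hdet, mul_pow, Complex.ofReal_mul])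
  have hQ' : Q * Qᴴ = 1 := Matrix.mem_unitaryGroup_iff.1 hQ
  have hMM : (K * Q)ᴴ * (K * Q) = !![((s ^ 2 : ℝ) : ℂ), 0; 0, ((t ^ 2 : ℝ) : ℂ)] := by
    rw [← hd, Matrix.conjTranspose_mul]
    simp only [Matrix.mul_assoc]
  obtain ⟨U, hU, h⟩ := (K * Q).exists_unitary_mul_diagonal (t := t) hs (by rw [hMM]; simp)
    (by rw [hMM]; simp) (by
      have h1 : ‖Q.det‖ = 1 := CStarRing.norm_of_mem_unitary (Matrix.det_of_mem_unitary hQ)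
      rw [Matrix.det_mul, norm_mul, hdet, h1, mul_one])
  refine ⟨⟨U, hU⟩, ⟨Qᴴ, Unitary.star_mem hQ⟩, ?_⟩
  rw [← h, Matrix.mul_assoc, hQ', Matrix.mul_one]

/-- The diagonal entries `s, t` of `concurrenceDiag C` satisfy `s² + t² = 1` and `2 s t = C`, so
they are the singular values of a matrix with `Tr (Kᴴ K) = 1` and `2 |det K| = C`. -/
theorem exists_unitary_eq_concurrenceDiag (K : Matrix (Fin 2) (Fin 2) ℂ) {C q : ℝ} (hC : 0 ≤ C)
    (hC' : C ≤ 1) (htr : (Kᴴ * K).trace = (q : ℂ)) (hdet : 2 * ‖K.det‖ = C * q) (hq : 0 ≤ q) :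
    ∃ U V : Matrix.unitaryGroup (Fin 2) ℂ, K = ((√q : ℝ) : ℂ) •
      ((U : Matrix (Fin 2) (Fin 2) ℂ) * concurrenceDiag C * (V : Matrix (Fin 2) (Fin 2) ℂ)) := by
  rcases hq.eq_or_lt with rfl | hq
  -- For `q = 0` the matrix vanishes, and any two unitary matrices do.
  · refine ⟨1, 1, ?_⟩
    rw [Complex.ofReal_zero, Matrix.trace_conjTranspose_mul_self_eq_zero_iff] at htr
    simp [htr]
  have ha := Real.sq_sqrt (show 0 ≤ 1 + C by linarith)
  have hb := Real.sq_sqrt (show 0 ≤ 1 - C by linarith)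
  have hr := Real.sq_sqrt hq.le
  have ha0 : 0 < √(1 + C) := Real.sqrt_pos.2 (by linarith)
  obtain ⟨U, V, h⟩ := K.exists_unitary_mul_diagonal_mul
    (s := √q * (1 / 2 * (√(1 + C) + √(1 - C)))) (t := √q * (1 / 2 * (√(1 + C) - √(1 - C))))
    (by positivity) (by
      rw [htr]
      norm_cast
      linear_combination (-q/2) * (ha + hb) - (1/2) * hr * (√(1 + C) ^ 2 + √(1 - C) ^ 2)) (by
      linear_combination (1 / 2) * hdet - (q/4) * (ha - hb) -
        (1/4) * hr * (√(1 + C) ^ 2 - √(1 - C) ^ 2))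
  refine ⟨U, V, h.trans ?_⟩
  rw [← Matrix.smul_mul, ← Matrix.mul_smul]
  congr 2
  ext i j
  fin_cases i <;> fin_cases j <;> simp [concurrenceDiag]

/-! ### The form `bᵀ (σ_y ⊗ σ_y) b` -/

theorem pauliY_kronecker_apply (a i b j : Fin 2) :
    (pauliY ⊗ₖ pauliY) (a, i) (b, j) = pauliY a b * pauliY i j := rfl

theorem transpose_pauliY : pauliYᵀ = -pauliY := by
  ext i j
  fin_cases i <;> fin_cases j <;> simp [pauliY]

theorem transpose_mul_mul_mul_mul {m n : Type*} [Fintype m] [Fintype n] (B : Matrix m n ℂ)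
    (Y : Matrix m m ℂ) (Q : Matrix n n ℂ) :
    (B * Q)ᵀ * Y * (B * Q) = Qᵀ * (Bᵀ * Y * B) * Q := by
  rw [Matrix.transpose_mul]
  simp only [Matrix.mul_assoc]

theorem map_star_pauliY : pauliY.map star = -pauliY := by
  ext i j
  fin_cases i <;> fin_cases j <;> simp [pauliY]

theorem transpose_pauliY_kronecker : (pauliY ⊗ₖ pauliY)ᵀ = pauliY ⊗ₖ pauliY := by
  ext ⟨a, i⟩ ⟨b, j⟩
  have h (x y : Fin 2) : pauliY y x = -pauliY x y := congrFun (congrFun transpose_pauliY x) y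
  rw [Matrix.transpose_apply, pauliY_kronecker_apply, pauliY_kronecker_apply, h a b, h i j,
    neg_mul_neg]

theorem map_star_pauliY_kronecker : (pauliY ⊗ₖ pauliY).map star = pauliY ⊗ₖ pauliY := by
  ext ⟨a, i⟩ ⟨b, j⟩
  have h (x y : Fin 2) : star (pauliY x y) = -pauliY x y :=
    congrFun (congrFun map_star_pauliY x) y
  rw [Matrix.map_apply, pauliY_kronecker_apply, star_mul', h a b, h i j, neg_mul_neg]

/-- The matrix of the `k`-th column of `B`, read as a vector of `ℂ² ⊗ ℂ²`: the tensor factor that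
carries the output becomes the row index. -/
def columnMatrix {n : ℕ} (B : Matrix (Fin 2 × Fin 2) (Fin n) ℂ) (k : Fin n) :
    Matrix (Fin 2) (Fin 2) ℂ :=
  Matrix.of fun i a => B (a, i) k

section
variable {n : ℕ} (B : Matrix (Fin 2 × Fin 2) (Fin n) ℂ) (k : Fin n)

theorem transpose_mul_pauliY_kronecker_mul_apply_self :
    (Bᵀ * (pauliY ⊗ₖ pauliY) * B) k k = -2 * (columnMatrix B k).det := by
  simp only [Matrix.mul_apply, Fintype.sum_prod_type, Fin.sum_univ_two, pauliY_kronecker_apply,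
    Matrix.det_fin_two, columnMatrix, Matrix.of_apply, Matrix.transpose_apply]
  simp only [pauliY, Matrix.of_apply, Matrix.cons_val]
  linear_combination (2 * B (0, 0) k * B (1, 1) k - 2 * B (1, 0) k * B (0, 1) k) * Complex.I_mul_I

theorem conjTranspose_mul_self_apply_self :
    (Bᴴ * B) k k = ((columnMatrix B k)ᴴ * columnMatrix B k).trace := by
  simp only [Matrix.mul_apply, Fintype.sum_prod_type, Fin.sum_univ_two, Matrix.trace_fin_two,
    columnMatrix, Matrix.of_apply, Matrix.conjTranspose_apply]

theorem conjTranspose_mul_self_apply_self_eq_sum :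
    (Bᴴ * B) k k = ((∑ r, ‖B r k‖ ^ 2 : ℝ) : ℂ) := by
  rw [Matrix.mul_apply]
  push_cast
  refine Finset.sum_congr rfl fun r _ => ?_
  rw [Matrix.conjTranspose_apply, Complex.star_def, Complex.conj_mul']

/-- The concurrence of a pure state is at most one. -/
theorem norm_transpose_mul_pauliY_kronecker_mul_apply_self_le :
    ‖(Bᵀ * (pauliY ⊗ₖ pauliY) * B) k k‖ ≤ ((Bᴴ * B) k k).re := by
  rw [transpose_mul_pauliY_kronecker_mul_apply_self, conjTranspose_mul_self_apply_self_eq_sum,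
    Complex.ofReal_re, norm_mul, norm_neg, Complex.norm_ofNat, Matrix.det_fin_two]
  simp only [columnMatrix, Matrix.of_apply, Fintype.sum_prod_type, Fin.sum_univ_two]
  have h := norm_sub_le (B (0, 0) k * B (1, 1) k) (B (1, 0) k * B (0, 1) k)
  rw [norm_mul, norm_mul] at h
  linarith [two_mul_le_add_sq ‖B (0, 0) k‖ ‖B (1, 1) k‖,
    two_mul_le_add_sq ‖B (1, 0) k‖ ‖B (0, 1) k‖]

end

/-! ### The concurrence in terms of a Takagi factorization -/

section
variable {B : Matrix (Fin 2 × Fin 2) (Fin 4) ℂ} {d : Fin 4 → ℝ}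

/-- With `Y = σ_y ⊗ σ_y`, the matrix `B Bᴴ Y (B Bᴴ)^* Y` has the same characteristic polynomial as
`(Bᵀ Y B)^* (Bᵀ Y B) = diag d²`. -/
theorem concurrenceSpectrum_mul_conjTranspose (h0 : ∀ i, 0 ≤ d i) (hd : Antitone d)
    (hB : Bᵀ * (pauliY ⊗ₖ pauliY) * B = Matrix.diagonal fun i => (d i : ℂ)) :
    concurrenceSpectrum (B * Bᴴ) = List.ofFn d := by
  have hB' : Bᴴ * (pauliY ⊗ₖ pauliY) * B.map star = Matrix.diagonal fun i => (d i : ℂ) := by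
    have h := congrArg (fun M => M.map (starRingEnd ℂ)) hB
    simp only [Matrix.map_mul, Matrix.diagonal_map (map_zero (starRingEnd ℂ))] at h
    have hY : (pauliY ⊗ₖ pauliY).map (starRingEnd ℂ) = pauliY ⊗ₖ pauliY :=
      map_star_pauliY_kronecker
    rw [hY] at h
    refine Eq.trans h ?_
    congr 1
    ext i
    exact Complex.conj_ofReal _
  have hρ : (B * Bᴴ).map star = B.map star * Bᵀ := by
    ext i j
    simp [Matrix.mul_apply]
  have hchar : (B * Bᴴ * spinFlip (B * Bᴴ)).charpoly =
      (Matrix.diagonal fun i => ((d i ^ 2 : ℝ) : ℂ)).charpoly := by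
    rw [show B * Bᴴ * spinFlip (B * Bᴴ) =
        B * (Bᴴ * (pauliY ⊗ₖ pauliY) * B.map star * (Bᵀ * (pauliY ⊗ₖ pauliY))) by
      rw [spinFlip, hρ]; simp only [Matrix.mul_assoc],
      Matrix.charpoly_mul_comm_of_le _ _ (by simp), Matrix.mul_assoc, hB, hB',
      Matrix.diagonal_mul_diagonal]
    simp [sq]
  have hroots : (B * Bᴴ * spinFlip (B * Bᴴ)).charpoly.roots =
      Finset.univ.val.map fun i => ((d i ^ 2 : ℝ) : ℂ) := by
    rw [hchar, Matrix.charpoly_diagonal, ← Polynomial.roots_multiset_prod_X_sub_C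
      (Finset.univ.val.map fun i => ((d i ^ 2 : ℝ) : ℂ)), Multiset.map_map]
    rfl
  rw [concurrenceSpectrum, hroots, Multiset.map_map]
  simp only [Function.comp_def, Complex.ofReal_re, Real.sqrt_sq (h0 _)]
  rw [Fin.univ_val_map, Multiset.coe_sort]
  refine List.mergeSort_of_pairwise ?_
  rw [List.pairwise_ofFn]
  exact fun i j hij => by simpa using hd hij.le

theorem concurrence_mul_conjTranspose (h0 : ∀ i, 0 ≤ d i) (hd : Antitone d)
    (hB : Bᵀ * (pauliY ⊗ₖ pauliY) * B = Matrix.diagonal fun i => (d i : ℂ)) :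
    concurrence (B * Bᴴ) = max 0 (d 0 - d 1 - d 2 - d 3) := by
  rw [concurrence, concurrenceSpectrum_mul_conjTranspose h0 hd hB]
  simp [List.ofFn_succ]

end

open scoped MatrixOrder Matrix.Norms.L2Operator in
/-- Every positive semidefinite `ρ` is `B Bᴴ` for some `B` whose columns are orthogonal for the
bilinear form of `σ_y ⊗ σ_y`. -/
theorem Matrix.PosSemidef.exists_takagi_decomposition
    {ρ : Matrix (Fin 2 × Fin 2) (Fin 2 × Fin 2) ℂ} (hρ : ρ.PosSemidef) :
    ∃ (B : Matrix (Fin 2 × Fin 2) (Fin 4) ℂ) (d : Fin 4 → ℝ), ρ = B * Bᴴ ∧ (∀ i, 0 ≤ d i) ∧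
      Antitone d ∧ Bᵀ * (pauliY ⊗ₖ pauliY) * B = Matrix.diagonal fun i => (d i : ℂ) := by
  obtain ⟨A, hA⟩ : ∃ A : Matrix (Fin 2 × Fin 2) (Fin 2 × Fin 2) ℂ, ρ = A * Aᴴ :=
    CStarAlgebra.nonneg_iff_eq_mul_star_self.1 hρ.nonneg
  let e : Fin 4 ≃ Fin 2 × Fin 2 := (finProdFinEquiv (m := 2) (n := 2)).symm
  let A' := A.submatrix id e
  obtain ⟨W, d, hW, h0, hd, h⟩ :=
    (A'ᵀ * (pauliY ⊗ₖ pauliY) * A').exists_takagi (by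
      rw [Matrix.transpose_mul, Matrix.transpose_mul, Matrix.transpose_transpose,
        transpose_pauliY_kronecker, Matrix.mul_assoc])
  refine ⟨A' * W, d, ?_, h0, hd, ?_⟩
  · rw [Matrix.conjTranspose_mul, Matrix.mul_assoc, ← Matrix.mul_assoc W,
      show W * Wᴴ = 1 from Matrix.mem_unitaryGroup_iff.1 hW, Matrix.one_mul, hA]
    simp only [A', Matrix.conjTranspose_submatrix, Matrix.submatrix_mul_equiv]
    rfl
  · rw [← h, transpose_mul_mul_mul_mul]

/-! ### Decompositions into vectors of equal concurrence -/

theorem map_ofReal_mem_unitaryGroup {n : ℕ} {O : Matrix (Fin n) (Fin n) ℝ}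
    (hO : O ∈ Matrix.orthogonalGroup (Fin n) ℝ) :
    O.map ((↑) : ℝ → ℂ) ∈ Matrix.unitaryGroup (Fin n) ℂ := by
  rw [Matrix.mem_unitaryGroup_iff, Matrix.star_eq_conjTranspose]
  ext i j
  have h : (O * Oᵀ) i j = (1 : Matrix (Fin n) (Fin n) ℝ) i j := by
    rw [(Matrix.mem_orthogonalGroup_iff _ _).1 hO]
  rw [Matrix.mul_apply, Matrix.one_apply] at h ⊢
  simp only [Matrix.conjTranspose_apply, Matrix.transpose_apply, Matrix.map_apply,
    Complex.star_def, Complex.conj_ofReal] at h ⊢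
  rw [← Complex.ofReal_one, ← Complex.ofReal_zero, ← apply_ite, ← h, Complex.ofReal_sum]
  simp only [Complex.ofReal_mul]

section
variable {B : Matrix (Fin 2 × Fin 2) (Fin 4) ℂ} {x : Fin 4 → ℝ}

/-- If the columns of `B` are orthogonal for the bilinear form of `σ_y ⊗ σ_y`, with real values `x`,
some unitary mixing gives columns on which the form is the same multiple `∑ i, x i` of the squared
norm. The mixing matrix is real orthogonal, which is why the real part of `Bᴴ B` suffices. -/
theorem exists_unitary_equalizing (hB : (Bᴴ * B).trace = 1)
    (hx : Bᵀ * (pauliY ⊗ₖ pauliY) * B = Matrix.diagonal fun i => (x i : ℂ)) :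
    ∃ Q ∈ Matrix.unitaryGroup (Fin 4) ℂ, ∀ k,
      ((B * Q)ᵀ * (pauliY ⊗ₖ pauliY) * (B * Q)) k k =
        ((∑ i, x i : ℝ) : ℂ) * (((((B * Q)ᴴ * (B * Q)) k k).re : ℝ) : ℂ) := by
  let G : Matrix (Fin 4) (Fin 4) ℝ := (Bᴴ * B).map Complex.re
  have hGt : Gᵀ = G := by
    ext i j
    have := congrFun (congrFun (Matrix.isHermitian_conjTranspose_mul_self B) i) j
    rw [Matrix.conjTranspose_apply] at this
    simp only [G, Matrix.transpose_apply, Matrix.map_apply]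
    rw [← this, Complex.star_def, Complex.conj_re]
  have hGtr : G.trace = 1 := by
    have := congrArg Complex.re hB
    simpa [Matrix.trace, G] using this
  obtain ⟨O, hO, hS⟩ := exists_orthogonal_conj_diag_eq_zero
    (Matrix.diagonal x - (∑ i, x i) • G) (by
      rw [Matrix.transpose_sub, Matrix.transpose_smul, hGt, Matrix.diagonal_transpose]) (by
      rw [Matrix.trace_sub, Matrix.trace_smul, hGtr, Matrix.trace_diagonal, smul_eq_mul, mul_one,
        sub_self])
  obtain ⟨P, hP⟩ : ∃ P : Matrix (Fin 4) (Fin 4) ℂ, P = O.map fun r => (r : ℂ) := ⟨_, rfl⟩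
  have hPa (i j) : P i j = O i j := by rw [hP, Matrix.map_apply]
  have hPt : Pᴴ = Pᵀ := by
    ext i j
    rw [Matrix.conjTranspose_apply, Matrix.transpose_apply, hPa]
    exact Complex.conj_ofReal _
  refine ⟨P, ?_, fun k => ?_⟩
  · rw [hP]
    exact map_ofReal_mem_unitaryGroup hO
  · have h1 : ((B * P)ᵀ * (pauliY ⊗ₖ pauliY) * (B * P)) k k =
        (((Oᵀ * Matrix.diagonal x * O) k k : ℝ) : ℂ) := by
      rw [transpose_mul_mul_mul_mul, hx]
      simp only [Matrix.mul_apply (N := P), Matrix.mul_apply (N := O), Matrix.mul_diagonal,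
        Matrix.transpose_apply, hPa, Complex.ofReal_sum, Complex.ofReal_mul]
    have h2 : (((B * P)ᴴ * (B * P)) k k).re = (Oᵀ * G * O) k k := by
      rw [Matrix.conjTranspose_mul, show Pᴴ * Bᴴ * (B * P) = Pᵀ * (Bᴴ * B) * P by
        rw [hPt]; simp only [Matrix.mul_assoc]]
      simp only [Matrix.mul_apply (N := P), Matrix.mul_apply (N := O), Matrix.mul_apply (M := Pᵀ),
        Matrix.mul_apply (M := Oᵀ), G, Matrix.map_apply, Matrix.transpose_apply, hPa,
        Complex.re_sum, Complex.re_mul_ofReal, Complex.re_ofReal_mul]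
    rw [h1, h2, ← Complex.ofReal_mul]
    congr 1
    have := hS k
    rw [Matrix.mul_sub, Matrix.sub_mul, Matrix.sub_apply, Matrix.mul_smul, Matrix.smul_mul,
      Matrix.smul_apply, smul_eq_mul] at this
    linarith

end

/-- **Wootters' theorem**: a two-qubit state `ρ` is a sum of four (unnormalized) pure states each of
which has the concurrence of `ρ`. -/
theorem exists_decomposition_concurrence {ρ : Matrix (Fin 2 × Fin 2) (Fin 2 × Fin 2) ℂ}
    (hρ : ρ.PosSemidef) (htr : ρ.trace = 1) :
    concurrence ρ ≤ 1 ∧ ∃ B : Matrix (Fin 2 × Fin 2) (Fin 4) ℂ, ρ = B * Bᴴ ∧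
      ∀ k, ‖(Bᵀ * (pauliY ⊗ₖ pauliY) * B) k k‖ = concurrence ρ * ((Bᴴ * B) k k).re := by
  obtain ⟨B, d, rfl, h0, hd, hB⟩ := hρ.exists_takagi_decomposition
  rw [concurrence_mul_conjTranspose h0 hd hB]
  have hBu {Q : Matrix (Fin 4) (Fin 4) ℂ} (hQ : Q ∈ Matrix.unitaryGroup (Fin 4) ℂ) :
      B * Bᴴ = B * Q * (B * Q)ᴴ := by
    rw [Matrix.conjTranspose_mul, Matrix.mul_assoc, ← Matrix.mul_assoc Q,
      show Q * Qᴴ = 1 from Matrix.mem_unitaryGroup_iff.1 hQ, Matrix.one_mul]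
  have hconj (w : Fin 4 → ℂ) : (B * Matrix.diagonal w)ᵀ * (pauliY ⊗ₖ pauliY) *
      (B * Matrix.diagonal w) = Matrix.diagonal fun i => w i ^ 2 * d i := by
    rw [transpose_mul_mul_mul_mul, hB, Matrix.diagonal_transpose, Matrix.diagonal_mul_diagonal,
      Matrix.diagonal_mul_diagonal]
    congr 1
    ext i
    ring
  have hdiag {w : Fin 4 → ℂ} (hw : ∀ i, ‖w i‖ = 1) :
      Matrix.diagonal w ∈ Matrix.unitaryGroup (Fin 4) ℂ := by
    rw [Matrix.mem_unitaryGroup_iff, Matrix.star_eq_conjTranspose, Matrix.diagonal_conjTranspose,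
      Matrix.diagonal_mul_diagonal, ← Matrix.diagonal_one]
    congr 1
    ext i
    rw [Pi.star_apply, Complex.star_def, Complex.mul_conj, Complex.normSq_eq_norm_sq, hw]
    norm_num
  rcases le_total (d 0) (d 1 + d 2 + d 3) with h | h
  · rw [max_eq_left (by linarith)]
    refine ⟨zero_le_one, ?_⟩
    obtain ⟨w, hw, hsum⟩ := exists_phases_sum_eq_zero d h0 hd h
    have hH : hadamardFour.map ((↑) : ℝ → ℂ) ∈ Matrix.unitaryGroup (Fin 4) ℂ :=
      map_ofReal_mem_unitaryGroup hadamardFour_mem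
    refine ⟨_, hBu (mul_mem (hdiag hw) hH), fun k => ?_⟩
    rw [← Matrix.mul_assoc B, transpose_mul_mul_mul_mul, hconj,
      transpose_mul_diagonal_mul_hadamardFour_apply, hsum, zero_div, norm_zero, zero_mul]
  · rw [max_eq_right (by linarith)]
    -- Multiplying the last three vectors by `i` turns `d 1, d 2, d 3` into their negatives.
    let w : Fin 4 → ℂ := ![1, Complex.I, Complex.I, Complex.I]
    have hw : ∀ i, ‖w i‖ = 1 := fun i => by fin_cases i <;> simp [w]
    let x : Fin 4 → ℝ := ![d 0, -d 1, -d 2, -d 3]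
    have hx : (fun i => w i ^ 2 * (d i : ℂ)) = fun i => (x i : ℂ) := by
      ext i
      fin_cases i <;> simp [w, x]
    have hxs : ∑ i, x i = d 0 - d 1 - d 2 - d 3 := by
      simp [x, Fin.sum_univ_four]
      ring
    have hBw := hconj w
    rw [hx] at hBw
    have htrw : ((B * Matrix.diagonal w)ᴴ * (B * Matrix.diagonal w)).trace = 1 := by
      rw [Matrix.trace_mul_comm, ← hBu (hdiag hw), htr]
    obtain ⟨Q, hQ, hQk⟩ := exists_unitary_equalizing htrw hBw
    rw [hxs] at hQk
    refine ⟨?_, _, hBu (mul_mem (hdiag hw) hQ), fun k => ?_⟩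
    · have h1 : ∑ k, x k = ∑ k, (((B * Matrix.diagonal w)ᵀ * (pauliY ⊗ₖ pauliY) *
          (B * Matrix.diagonal w)) k k).re := by
        rw [hBw]; simp
      rw [← hxs, h1]
      calc _ ≤ ∑ k, (((B * Matrix.diagonal w)ᴴ * (B * Matrix.diagonal w)) k k).re :=
            Finset.sum_le_sum fun k _ => (Complex.re_le_norm _).trans
              (norm_transpose_mul_pauliY_kronecker_mul_apply_self_le _ k)
        _ = 1 := by
            rw [← Complex.re_sum]
            exact congrArg Complex.re htrw
    · rw [← Matrix.mul_assoc B, hQk, norm_mul, Complex.norm_real, Complex.norm_real,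
        Real.norm_of_nonneg (by linarith), Real.norm_of_nonneg]
      exact (norm_nonneg _).trans (norm_transpose_mul_pauliY_kronecker_mul_apply_self_le _ k)

/-! ### Dual operators and Kraus operators -/

theorem dualOperator_apply {n : ℕ} (Φ : Matrix (Fin n) (Fin n) ℂ →ₗ[ℂ] Matrix (Fin n) (Fin n) ℂ)
    (a b i j : Fin n) : dualOperator Φ (a, i) (b, j) = Φ (Matrix.single a b 1) i j := by
  refine congrArg (fun M => Φ M i j) ?_
  ext x y
  simp only [Matrix.of_apply, Matrix.vecMulVec_apply, maxEntangled, Pi.star_apply,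
    Matrix.single_apply]
  split_ifs <;> simp_all

theorem eq_of_dualOperator_eq {n : ℕ}
    {Φ Ψ : Matrix (Fin n) (Fin n) ℂ →ₗ[ℂ] Matrix (Fin n) (Fin n) ℂ}
    (h : dualOperator Φ = dualOperator Ψ) : Φ = Ψ := by
  refine Matrix.ext_linearMap ℂ fun a b => LinearMap.ext_ring ?_
  ext i j
  simpa [dualOperator_apply] using congrFun (congrFun h (a, i)) (b, j)

/-- The completely positive map `ρ ↦ ∑ k, K k * ρ * (K k)ᴴ` with Kraus operators `K k`. -/
def krausMap {n m : ℕ} (K : Fin m → Matrix (Fin n) (Fin n) ℂ) :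
    Matrix (Fin n) (Fin n) ℂ →ₗ[ℂ] Matrix (Fin n) (Fin n) ℂ :=
  ∑ k, (LinearMap.mulRight ℂ (K k)ᴴ) ∘ₗ (LinearMap.mulLeft ℂ (K k))

theorem krausMap_apply {n m : ℕ} (K : Fin m → Matrix (Fin n) (Fin n) ℂ)
    (ρ : Matrix (Fin n) (Fin n) ℂ) : krausMap K ρ = ∑ k, K k * ρ * (K k)ᴴ := by
  simp [krausMap]

theorem dualOperator_krausMap_columnMatrix {m : ℕ} (B : Matrix (Fin 2 × Fin 2) (Fin m) ℂ) :
    dualOperator (krausMap (columnMatrix B)) = B * Bᴴ := by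
  ext ⟨a, i⟩ ⟨b, j⟩
  rw [dualOperator_apply, krausMap_apply, Matrix.sum_apply, Matrix.mul_apply]
  refine Finset.sum_congr rfl fun k _ => ?_
  simp [Matrix.mul_apply, Matrix.single_apply, columnMatrix, ite_and, Finset.sum_ite_eq]

theorem IsCompletelyPositive.posSemidef_dualOperator {n : ℕ}
    {Φ : Matrix (Fin n) (Fin n) ℂ →ₗ[ℂ] Matrix (Fin n) (Fin n) ℂ} (hΦ : IsCompletelyPositive Φ) :
    (dualOperator Φ).PosSemidef :=
  hΦ n _ (Matrix.posSemidef_vecMulVec_self_star _)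

theorem concurrence_nonneg (ρ : Matrix (Fin 2 × Fin 2) (Fin 2 × Fin 2) ℂ) : 0 ≤ concurrence ρ :=
  le_max_left _ _

theorem theorem10 (Φ : Matrix (Fin 2) (Fin 2) ℂ →ₗ[ℂ] Matrix (Fin 2) (Fin 2) ℂ)
    (hCP : IsCompletelyPositive Φ) (hΦ : Φ ≠ 0) :
    concurrence (dualState Φ) ≤ 1 ∧
    ∃ (k : ℕ) (p : Fin k → ℝ) (U V : Fin k → Matrix.unitaryGroup (Fin 2) ℂ),
      (∀ i, 0 ≤ p i) ∧
      ((∑ i, p i : ℝ) : ℂ) = (dualOperator Φ).trace ∧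
      ∀ ρ : Matrix (Fin 2) (Fin 2) ℂ,
        Φ ρ = ∑ i, (p i : ℂ) •
          (((U i : Matrix (Fin 2) (Fin 2) ℂ) * concurrenceDiag (concurrence (dualState Φ))
              * (V i : Matrix (Fin 2) (Fin 2) ℂ)) * ρ *
            ((U i : Matrix (Fin 2) (Fin 2) ℂ) * concurrenceDiag (concurrence (dualState Φ))
              * (V i : Matrix (Fin 2) (Fin 2) ℂ))ᴴ) := by
  have hpos := hCP.posSemidef_dualOperator
  have htr0 : (dualOperator Φ).trace ≠ 0 := fun h => hΦ (eq_of_dualOperator_eq (by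
    rw [hpos.trace_eq_zero_iff.1 h]
    ext ⟨a, i⟩ ⟨b, j⟩
    simp [dualOperator_apply]))
  obtain ⟨t, ht, htt⟩ : ∃ t : ℝ, 0 ≤ t ∧ (dualOperator Φ).trace = t :=
    ⟨_, (Complex.nonneg_iff.1 hpos.trace_nonneg).1, Complex.ext rfl
      (Complex.nonneg_iff.1 hpos.trace_nonneg).2.symm⟩
  have hstate : (dualState Φ).PosSemidef := by
    refine hpos.smul ?_
    rw [htt, ← Complex.ofReal_inv]
    exact Complex.zero_le_real.2 (inv_nonneg.2 ht)
  have hstr : (dualState Φ).trace = 1 := by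
    rw [dualState, Matrix.trace_smul, smul_eq_mul, inv_mul_cancel₀ htr0]
  obtain ⟨hC, B, hB, hBk⟩ := exists_decomposition_concurrence hstate hstr
  have hC0 := concurrence_nonneg (dualState Φ)
  have hΦB : Φ = (t : ℂ) • krausMap (columnMatrix B) := by
    apply eq_of_dualOperator_eq
    have h1 : dualOperator ((t : ℂ) • krausMap (columnMatrix B)) = (t : ℂ) • (B * Bᴴ) := by
      rw [← dualOperator_krausMap_columnMatrix]
      ext ⟨a, i⟩ ⟨b, j⟩
      simp [dualOperator_apply]
    rw [h1, ← hB, dualState, ← htt, smul_smul, mul_inv_cancel₀ htr0, one_smul]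
  let q : Fin 4 → ℝ := fun k => ∑ r, ‖B r k‖ ^ 2
  have hq : ∀ k, 0 ≤ q k := fun k => Finset.sum_nonneg fun r _ => by positivity
  have hBq : ∀ k, (Bᴴ * B) k k = (q k : ℂ) := conjTranspose_mul_self_apply_self_eq_sum B
  have hK (k : Fin 4) := exists_unitary_eq_concurrenceDiag (columnMatrix B k) hC0 hC
    (q := q k) (by rw [← conjTranspose_mul_self_apply_self, hBq]) (by
      have := hBk k
      rw [transpose_mul_pauliY_kronecker_mul_apply_self, hBq, Complex.ofReal_re, norm_mul,
        norm_neg, Complex.norm_ofNat] at this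
      exact this) (hq k)
  choose U V hUV using hK
  refine ⟨hC, 4, fun k => t * q k, U, V, fun k => mul_nonneg ht (hq k), ?_, fun ρ => ?_⟩
  · have : (Bᴴ * B).trace = 1 := by rw [Matrix.trace_mul_comm, ← hB, hstr]
    rw [htt, ← Finset.mul_sum, Complex.ofReal_mul, Complex.ofReal_sum]
    simp only [← hBq]
    exact (congrArg _ this).trans (mul_one _)
  · conv_lhs => rw [hΦB]
    rw [LinearMap.smul_apply, krausMap_apply, Finset.smul_sum]
    refine Finset.sum_congr rfl fun k _ => ?_
    conv_lhs => rw [hUV k]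
    rw [Matrix.conjTranspose_smul, Matrix.smul_mul, Matrix.smul_mul, Matrix.mul_smul, smul_smul,
      smul_smul, Complex.star_def, Complex.conj_ofReal, mul_assoc, ← Complex.ofReal_mul,
      Real.mul_self_sqrt (hq k), ← Complex.ofReal_mul]
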